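/- **Theorem 3.1 (Orthonormality of refined basis).** Let $k$ be a field of characteristic $0$, and let $\psi_n,\psi_n^*$ ($n\in\mathbb Z$) be free fermions over $k$: $[\psi_m,\psi_n]_+=[\psi_m^*,\psi_n^*]_+=0$, $[\psi_m,\psi_n^*]_+=\delta_{m,n}$, where $[A,B]_+=AB+BA$. They act on the Fock space $\mathcal F$, the $k$-space with basis $$\psi_{n_1}\cdots\psi_{n_p}\psi^*_{m_1}\cdots\psi^*_{m_q}|0\rangle\qquad(n_1>\dots>n_p\ge 0>m_q>\dots>m_1),$$ where $\psi_m|0\rangle=\psi_n^*|0\rangle=0$ for $m<0\le n$. Let $\langle 0|$ be the linear functional on $\mathcal F$ with $\langle 0|0\rangle=1$ and $\langle 0|\psi_n=\langle 0|\psi_m^*=0$ for $m<0\le n$. Operators act on linear functionals ("bras") from the right by precomposition, and $\langle w|v\rangle$ is the value of $\langle w|$ at $|v\rangle$. For $r\ge 0$ put $$|-r\rangle=\psi^*_{-r}\cdots\psi^*_{-1}|0\rangle,\qquad \langle -r|=\langle 0|\psi_{-1}\cdots\psi_{-r}.$$ Let $a_m=\sum_{i\in\mathbb Z}{:}\psi_i\psi^*_{i+m}{:}$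 with ${:}\psi_i\psi_j^*{:}=\psi_i\psi_j^*-\langle 0|\psi_i\psi_j^*|0\rangle$. For a finite tuple $x=(x_1,\dots,x_M)$ in $k$ let $H(x)=\sum_{n>0}\frac{p_n(x)}{n}a_n$, where $p_n(x)=\sum_j x_j^n$. On every vector of $\mathcal F$ the sums defining $a_m$, $H(x)$ and $e^{\pm H(x)}$ have only finitely many nonzero terms. Let $t=(t_1,t_2,\dots)$ be any sequence in $k$, and let $[t]=(t[1],t[2],\dots)$, $t[i]=(t_1,\dots,t_{i-1})$, be the refined tuple. For partitions $\lambda,\mu$ (padded by zeros, with $\ell$ denoting the number of nonzero parts) and integers $r\ge\ell(\lambda)$, $s\ge\ell(\mu)$ put $$|\lambda\rangle_{[t]}=\psi_{\lambda_1-1}e^{H(t_1)}\psi_{\lambda_2-2}e^{H(t_2)}\cdots\psi_{\lambda_r-r}e^{H(t_r)}|-r\rangle,$$ $${}_{[t]}\langle\mu|=\langle -s|e^{-H(t_s)}\psi^*_{\mu_s-s}\cdots e^{-H(t_2)}\psi^*_{\mu_2-2}e^{-H(t_1)}\psi^*_{\mu_1-1}.$$ Then: 1. $|\lambda\rangle_{[t]}=\Big(\prod_{i=1}^{r}e^{H(t[i])}\psi_{\lambda_i-i}e^{-H(t[i])}\Big)|-r\rangle$,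 with the factors ordered from left to right; 2. $|\lambda\rangle_{[t]}$ does not depend on the choice of $r\ge\ell(\lambda)$; 3. ${}_{[t]}\langle\mu|$ does not depend on the choice of $s\ge\ell(\mu)$; 4. for all partitions $\lambda,\mu$, $${}_{[t]}\langle\mu|\lambda\rangle_{[t]}=\delta_{\lambda,\mu}.$$ -/

import Mathlib

/-!
Free fermions, the fermionic Fock space, Heisenberg operators, vertex-type exponentials and the
refined vectors.  Sequences indexed by `1, 2, 3, …` in the mathematics are indexed by `0, 1, 2, …`
here, so `t i` is the letter usually written `t_{i+1}`.
-/

noncomputable section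

namespace FreeFermion

variable {k : Type*} [Field k]

/-- The fermionic Fock space: the free `k`-space on the vectors
`ψ_{n₁} ⋯ ψ_{n_r} ψ*_{m₁} ⋯ ψ*_{m_s} |0⟩` with `n₁ > ⋯ > n_r ≥ 0 > m_s > ⋯ > m₁`, realised as the
exterior algebra on the free module whose `n`-th generator stands for `ψ_n` if `0 ≤ n` and for
`ψ*_n` if `n < 0`; the vector above is the exterior product of its letters. -/
abbrev Fock (k : Type*) [Field k] : Type _ := ExteriorAlgebra k (ℤ →₀ k)

/-- Exterior multiplication by the `n`-th generator. -/
def wedge (n : ℤ) : Module.End k (Fock k) :=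
  LinearMap.mulLeft k (ExteriorAlgebra.ι k (Finsupp.single n 1))

/-- Contraction (the odd derivation) with the `n`-th coordinate form. -/
def contr (n : ℤ) : Module.End k (Fock k) :=
  CliffordAlgebra.contractLeft (Finsupp.lapply n : (ℤ →₀ k) →ₗ[k] k)

/-- The operator `ψ_n`: it creates for `0 ≤ n` and annihilates for `n < 0`. -/
def psi (n : ℤ) : Module.End k (Fock k) := if 0 ≤ n then wedge n else contr n

/-- The operator `ψ*_n`: it annihilates for `0 ≤ n` and creates for `n < 0`. -/
def psiStar (n : ℤ) : Module.End k (Fock k) := if 0 ≤ n then contr n else wedge n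

/-- The vacuum vector `|0⟩`. -/
def vac : Fock k := 1

/-- The dual vacuum `⟨0|`, as a linear functional on the Fock space: the projection to the degree
zero part of the exterior algebra. Bras in general are linear functionals on the Fock space, and
`⟨w|v⟩` is the value of `⟨w|` at `|v⟩`; an operator acts on bras from the right, by
precomposition. -/
def braVac : Module.Dual k (Fock k) := (ExteriorAlgebra.algebraMapInv (R := k)).toLinearMap

section Relations

lemma wedge_apply (n : ℤ) (v : Fock k) :
    wedge n v = ExteriorAlgebra.ι k (Finsupp.single n 1) * v := rfl

lemma contr_ι_mul (n : ℤ) (w : ℤ →₀ k) (v : Fock k) :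
    contr n (ExteriorAlgebra.ι k w * v) = w n • v - ExteriorAlgebra.ι k w * contr n v := by
  unfold contr
  exact CliffordAlgebra.contractLeft_ι_mul _ _ _

lemma contr_algebraMap (n : ℤ) (c : k) : contr n (algebraMap k (Fock k) c) = 0 :=
  CliffordAlgebra.contractLeft_algebraMap (Q := 0) (Finsupp.lapply n : (ℤ →₀ k) →ₗ[k] k) c

lemma contr_one (n : ℤ) : contr n (1 : Fock k) = 0 := by
  simpa using contr_algebraMap n (1 : k)

lemma wedge_wedge (m n : ℤ) (v : Fock k) : wedge m (wedge n v) = - wedge n (wedge m v) := by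
  simp only [wedge_apply, ← mul_assoc]
  rw [eq_neg_of_add_eq_zero_left (ExteriorAlgebra.ι_add_mul_swap _ _), neg_mul]

lemma contr_contr (m n : ℤ) (v : Fock k) : contr m (contr n v) = - contr n (contr m v) :=
  CliffordAlgebra.contractLeft_comm (Q := 0) (Finsupp.lapply m : (ℤ →₀ k) →ₗ[k] k)
    (Finsupp.lapply n : (ℤ →₀ k) →ₗ[k] k) v

lemma contr_wedge (m n : ℤ) (v : Fock k) :
    contr m (wedge n v) = (if m = n then v else 0) - wedge n (contr m v) := by
  rw [wedge_apply, contr_ι_mul, wedge_apply, Finsupp.single_apply]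
  by_cases h : m = n
  · simp [h]
  · simp [h, Ne.symm h]

/-- `[ψ_m, ψ_n]₊ = 0`. -/
theorem psi_anticomm (m n : ℤ) : psi m * psi n + psi n * psi m = (0 : Module.End k (Fock k)) := by
  refine LinearMap.ext fun v => ?_
  simp only [LinearMap.add_apply, Module.End.mul_apply, LinearMap.zero_apply, psi]
  split_ifs
  · rw [wedge_wedge]; simp
  · rw [contr_wedge, if_neg (by omega)]; simp
  · rw [contr_wedge, if_neg (by omega)]; simp
  · rw [contr_contr]; simp

/-- `[ψ*_m, ψ*_n]₊ = 0`. -/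
theorem psiStar_anticomm (m n : ℤ) :
    psiStar m * psiStar n + psiStar n * psiStar m = (0 : Module.End k (Fock k)) := by
  refine LinearMap.ext fun v => ?_
  simp only [LinearMap.add_apply, Module.End.mul_apply, LinearMap.zero_apply, psiStar]
  split_ifs
  · rw [contr_contr]; simp
  · rw [contr_wedge, if_neg (by omega)]; simp
  · rw [contr_wedge, if_neg (by omega)]; simp
  · rw [wedge_wedge]; simp

/-- `[ψ_m, ψ*_n]₊ = δ_{m,n}`. -/
theorem psi_psiStar_anticomm (m n : ℤ) :
    psi m * psiStar n + psiStar n * psi m =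
      (if m = n then 1 else 0 : Module.End k (Fock k)) := by
  refine LinearMap.ext fun v => ?_
  by_cases hmn : m = n
  · subst hmn
    simp only [LinearMap.add_apply, Module.End.mul_apply, psi, psiStar]
    split_ifs <;> simp [contr_wedge]
  · simp only [LinearMap.add_apply, Module.End.mul_apply, psi, psiStar, if_neg hmn,
      LinearMap.zero_apply]
    split_ifs
    · rw [contr_wedge, if_neg (by omega)]; simp
    · rw [wedge_wedge]; simp
    · rw [contr_contr]; simp
    · rw [contr_wedge, if_neg (by omega)]; simp

/-- `ψ_m |0⟩ = 0` for `m < 0`. -/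
theorem psi_vac {m : ℤ} (hm : m < 0) : psi m vac = (0 : Fock k) := by
  rw [psi, if_neg (by omega)]; exact contr_one _

/-- `ψ*_n |0⟩ = 0` for `n ≥ 0`. -/
theorem psiStar_vac {n : ℤ} (hn : 0 ≤ n) : psiStar n vac = (0 : Fock k) := by
  rw [psiStar, if_pos hn]; exact contr_one _

lemma braVac_wedge (n : ℤ) (v : Fock k) : braVac (wedge n v) = 0 := by
  simp [braVac, wedge_apply, ExteriorAlgebra.algebraMapInv]

/-- `⟨0| ψ_n = 0` for `n ≥ 0`. -/
theorem braVac_psi {n : ℤ} (hn : 0 ≤ n) : braVac ∘ₗ psi n = (0 : Module.Dual k (Fock k)) := by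
  refine LinearMap.ext fun v => ?_
  rw [LinearMap.comp_apply, LinearMap.zero_apply]
  rw [psi, if_pos hn]; exact braVac_wedge n v

/-- `⟨0| ψ*_m = 0` for `m < 0`. -/
theorem braVac_psiStar {m : ℤ} (hm : m < 0) :
    braVac ∘ₗ psiStar m = (0 : Module.Dual k (Fock k)) := by
  refine LinearMap.ext fun v => ?_
  rw [LinearMap.comp_apply, LinearMap.zero_apply]
  rw [psiStar, if_neg (by omega)]; exact braVac_wedge m v

/-- `⟨0|0⟩ = 1`. -/
theorem braVac_vac : braVac (vac : Fock k) = 1 := by simp [braVac, vac]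

/-- Every vector is annihilated by `ψ*_n` and `ψ_{-n}` for all large `n`. -/
theorem eventually_annihilated (v : Fock k) :
    ∃ N : ℤ, 0 < N ∧ ∀ n : ℤ, N ≤ n → psiStar n v = 0 ∧ psi (-n) v = 0 := by
  suffices h : ∃ N : ℤ, 0 < N ∧ ∀ n : ℤ, N ≤ n → contr n v = 0 ∧ contr (-n) v = 0 by
    obtain ⟨N, hN, h⟩ := h
    refine ⟨N, hN, fun n hn => ?_⟩
    rw [psiStar, psi, if_pos (by omega), if_neg (by omega)]
    exact h n hn
  induction v using CliffordAlgebra.left_induction with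
  | algebraMap c => exact ⟨1, one_pos, fun n _ => ⟨contr_algebraMap n c, contr_algebraMap _ c⟩⟩
  | add x y hx hy =>
    obtain ⟨N, hN, hx⟩ := hx
    obtain ⟨M, -, hy⟩ := hy
    refine ⟨max N M, by omega, fun n hn => ?_⟩
    have h1 := hx n (by omega)
    have h2 := hy n (by omega)
    simp [map_add, h1, h2]
  | ι_mul x w hx =>
    obtain ⟨N, hN, hx⟩ := hx
    refine ⟨max N (∑ i ∈ w.support, |i| + 1), by omega, fun n hn => ?_⟩
    have hw : ∀ i : ℤ, |i| = n → w i = 0 := by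
      intro i hi
      by_contra hne
      have := Finset.single_le_sum (f := fun i : ℤ => |i|) (fun i _ => abs_nonneg i)
        (Finsupp.mem_support_iff.2 hne)
      omega
    have h1 := hx n (by omega)
    refine ⟨?_, ?_⟩
    · refine (contr_ι_mul n w x).trans ?_
      rw [h1.1, hw n (abs_of_pos (by omega))]; simp
    · refine (contr_ι_mul (-n) w x).trans ?_
      rw [h1.2, hw (-n) (by rw [abs_neg]; exact abs_of_pos (by omega))]; simp

end Relations

/-- The sum of a family of operators of which only finitely many are nonzero on each vector. -/
def sumEnd {ι : Type*} (f : ι → Module.End k (Fock k))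
    (hf : ∀ v, (Function.support fun i => f i v).Finite) : Module.End k (Fock k) where
  toFun v := ∑ᶠ i, f i v
  map_add' v w := by
    simp only [map_add]
    exact finsum_add_distrib (hf v) (hf w)
  map_smul' c v := by
    simp only [map_smul, RingHom.id_apply]
    exact (smul_finsum' c (hf v)).symm

/-- The normally ordered product `:ψ_i ψ*_j: = ψ_i ψ*_j - ⟨0|ψ_i ψ*_j|0⟩`. -/
def normalOrd (i j : ℤ) : Module.End k (Fock k) :=
  psi i * psiStar j - braVac (psi i (psiStar j (vac : Fock k))) • (1 : Module.End k (Fock k))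

lemma psi_psiStar_apply (i j : ℤ) (v : Fock k) :
    psi i (psiStar j v) = (if i = j then v else 0) - psiStar j (psi i v) := by
  have h := congrArg (fun T : Module.End k (Fock k) => T v) (psi_psiStar_anticomm (k := k) i j)
  simp only [LinearMap.add_apply, Module.End.mul_apply] at h
  rw [eq_sub_iff_add_eq, h]
  split_ifs <;> rfl

lemma normalOrd_apply_of_psiStar {i j : ℤ} {v : Fock k} (hj : 0 ≤ j) (h : psiStar j v = 0) :
    normalOrd i j v = 0 := by
  simp [normalOrd, h, psiStar_vac hj]

lemma normalOrd_apply_of_psi {i j : ℤ} {v : Fock k} (hi : i < 0) (h : psi i v = 0) :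
    normalOrd i j v = 0 := by
  simp only [normalOrd, LinearMap.sub_apply, Module.End.mul_apply, psi_psiStar_apply, h,
    psi_vac hi, LinearMap.smul_apply, Module.End.one_apply]
  split_ifs <;> simp [braVac_vac]

lemma normalOrd_support (m : ℤ) (v : Fock k) :
    (Function.support fun i => normalOrd i (i + m) v).Finite := by
  obtain ⟨N, hN, h⟩ := eventually_annihilated v
  refine (Set.finite_Icc (-N) (N - m)).subset fun i hi => ?_
  by_contra hni
  apply hi
  rw [Set.mem_Icc, not_and_or] at hni
  rcases hni with h1 | h1
  · have := (h (-i) (by omega)).2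
    rw [neg_neg] at this
    exact normalOrd_apply_of_psi (by omega) this
  · exact normalOrd_apply_of_psiStar (by omega) (h (i + m) (by omega)).1

/-- The Heisenberg operator `a_m = ∑_{i ∈ ℤ} :ψ_i ψ*_{i+m}:`. -/
def heis (m : ℤ) : Module.End k (Fock k) :=
  sumEnd (fun i : ℤ => normalOrd i (i + m)) (normalOrd_support m)

lemma heis_eventually_zero (v : Fock k) : ∃ N : ℤ, ∀ m, N ≤ m → heis m v = 0 := by
  obtain ⟨N, hN, h⟩ := eventually_annihilated v
  refine ⟨2 * N, fun m hm => ?_⟩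
  change ∑ᶠ i : ℤ, normalOrd i (i + m) v = 0
  rw [← finsum_zero (α := ℤ) (M := Fock k)]
  congr 1
  funext i
  by_cases hi : N ≤ i + m
  · exact normalOrd_apply_of_psiStar (by omega) (h _ hi).1
  · have := (h (-i) (by omega)).2
    rw [neg_neg] at this
    exact normalOrd_apply_of_psi (by omega) this

/-- The supersymmetric power sum `p_n(x/y) = ∑ x_i ^ n - ∑ y_j ^ n` of two finite tuples. -/
def powerSum (x y : List k) (n : ℕ) : k := (x.map (· ^ n)).sum - (y.map (· ^ n)).sum

/-- The operator `H(x/y) = ∑_{n > 0} (p_n(x/y) / n) a_n`. -/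
def opH (x y : List k) : Module.End k (Fock k) :=
  sumEnd (fun n : ℕ => (powerSum x y (n + 1) / ((n + 1 : ℕ) : k)) • heis ((n + 1 : ℕ) : ℤ))
    (by
      intro v
      obtain ⟨N, h⟩ := heis_eventually_zero v
      refine (Set.finite_Iio N.toNat).subset fun n hn => ?_
      by_contra hlt
      apply hn
      rw [Set.mem_Iio, not_lt] at hlt
      simp only [LinearMap.smul_apply]
      rw [h _ (by omega), smul_zero])

/-- The exponential `∑_j T^j / j!` of an operator each vector of which is killed by some power. -/
def expEnd (T : Module.End k (Fock k)) (hT : ∀ v, ∃ j : ℕ, (T ^ j) v = 0) :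
    Module.End k (Fock k) :=
  sumEnd (fun j : ℕ => ((j.factorial : k)⁻¹) • T ^ j)
    (by
      intro v
      obtain ⟨N, h⟩ := hT v
      refine (Set.finite_Iio N).subset fun n hn => ?_
      by_contra hlt
      apply hn
      rw [Set.mem_Iio, not_lt] at hlt
      simp only [LinearMap.smul_apply]
      obtain ⟨d, rfl⟩ := Nat.exists_eq_add_of_le' hlt
      rw [pow_add, Module.End.mul_apply, h, map_zero, smul_zero])

section Energy

/-- Twice the energy of a monomial in the generators. -/
def energy (l : List ℤ) : ℤ := (l.map fun n => |2 * n + 1|).sum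

/-- The span of the monomials of bounded energy. -/
def energyLE (k : Type*) [Field k] (E : ℤ) : Submodule k (Fock k) :=
  Submodule.span k {v | ∃ l : List ℤ, energy l ≤ E ∧
    v = (l.map fun n => ExteriorAlgebra.ι k (Finsupp.single n (1 : k))).prod}

lemma energy_nonneg (l : List ℤ) : 0 ≤ energy l :=
  List.sum_nonneg (by simp only [List.mem_map]; rintro _ ⟨n, -, rfl⟩; exact abs_nonneg _)

lemma energyLE_neg {E : ℤ} (hE : E < 0) : energyLE k E = ⊥ := by
  rw [energyLE, Submodule.span_eq_bot]
  rintro v ⟨l, hl, -⟩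
  have := energy_nonneg l
  omega

lemma energyLE_mono {E E' : ℤ} (h : E ≤ E') : energyLE k E ≤ energyLE k E' :=
  Submodule.span_mono fun _ ⟨l, hl, hv⟩ => ⟨l, hl.trans h, hv⟩

lemma wedge_mem {E : ℤ} (n : ℤ) {v : Fock k} (hv : v ∈ energyLE k E) :
    wedge n v ∈ energyLE k (E + |2 * n + 1|) := by
  induction hv using Submodule.span_induction with
  | mem v h =>
    obtain ⟨l, hl, rfl⟩ := h
    refine Submodule.subset_span ⟨n :: l, ?_, by simp [wedge_apply]⟩
    simp only [energy, List.map_cons, List.sum_cons] at hl ⊢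
    omega
  | zero => simp
  | add x y _ _ hx hy => rw [map_add]; exact add_mem hx hy
  | smul c x _ hx => rw [map_smul]; exact Submodule.smul_mem _ _ hx

lemma contr_mem {E : ℤ} (n : ℤ) {v : Fock k} (hv : v ∈ energyLE k E) :
    contr n v ∈ energyLE k (E - |2 * n + 1|) := by
  induction hv using Submodule.span_induction with
  | mem v h =>
    obtain ⟨l, hl, rfl⟩ := h
    refine energyLE_mono (sub_le_sub_right hl _) ?_
    clear hl
    induction l with
    | nil =>
      simp [contr_one]
    | cons m l ih =>
      rw [List.map_cons, List.prod_cons, ← wedge_apply, contr_wedge]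
      refine sub_mem ?_ ?_
      · split_ifs with h
        · subst h
          refine Submodule.subset_span ⟨l, ?_, rfl⟩
          simp [energy]
        · exact zero_mem _
      · have := wedge_mem m ih
        convert this using 2
        simp only [energy, List.map_cons, List.sum_cons]
        ring
  | zero => simp
  | add x y _ _ hx hy => rw [map_add]; exact add_mem hx hy
  | smul c x _ hx => rw [map_smul]; exact Submodule.smul_mem _ _ hx

lemma psi_mem {E : ℤ} (n : ℤ) {v : Fock k} (hv : v ∈ energyLE k E) :
    psi n v ∈ energyLE k (E + (2 * n + 1)) := by
  rw [psi]
  split_ifs with h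
  · have := wedge_mem n hv
    rwa [abs_of_nonneg (by omega)] at this
  · have := contr_mem n hv
    rwa [abs_of_neg (by omega), sub_neg_eq_add] at this

lemma psiStar_mem {E : ℤ} (n : ℤ) {v : Fock k} (hv : v ∈ energyLE k E) :
    psiStar n v ∈ energyLE k (E - (2 * n + 1)) := by
  rw [psiStar]
  split_ifs with h
  · have := contr_mem n hv
    rwa [abs_of_nonneg (by omega)] at this
  · have := wedge_mem n hv
    rwa [abs_of_neg (by omega), ← sub_eq_add_neg] at this

lemma normalOrd_of_ne {i j : ℤ} (h : i ≠ j) :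
    normalOrd i j = (psi i * psiStar j : Module.End k (Fock k)) := by
  have : braVac (psi i (psiStar j (vac : Fock k))) = 0 := by
    by_cases hi : 0 ≤ i
    · exact LinearMap.congr_fun (braVac_psi hi) _
    · rw [psi_psiStar_apply, psi_vac (by omega), if_neg h]; simp
  rw [normalOrd, this, zero_smul, sub_zero]

lemma heis_mem {E m : ℤ} (hm : 0 < m) {v : Fock k} (hv : v ∈ energyLE k E) :
    heis m v ∈ energyLE k (E - 2) := by
  change ∑ᶠ i : ℤ, normalOrd i (i + m) v ∈ _
  refine finsum_induction (· ∈ energyLE k (E - 2)) (zero_mem _) (fun _ _ => add_mem) fun i => ?_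
  rw [normalOrd_of_ne (by omega)]
  exact energyLE_mono (by omega) (psi_mem i (psiStar_mem (i + m) hv))

lemma opH_mem {E : ℤ} (x y : List k) {v : Fock k} (hv : v ∈ energyLE k E) :
    opH x y v ∈ energyLE k (E - 2) := by
  refine finsum_induction (· ∈ energyLE k (E - 2)) (zero_mem _) (fun _ _ => add_mem) fun n => ?_
  exact Submodule.smul_mem _ _ (heis_mem (by omega) hv)

lemma exists_mem_energyLE (v : Fock k) : ∃ E : ℤ, v ∈ energyLE k E := by
  induction v using CliffordAlgebra.left_induction with
  | algebraMap c =>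
    refine ⟨0, ?_⟩
    rw [Algebra.algebraMap_eq_smul_one]
    exact Submodule.smul_mem _ _ (Submodule.subset_span ⟨[], by simp [energy], by simp⟩)
  | add x y hx hy =>
    obtain ⟨E, hx⟩ := hx
    obtain ⟨F, hy⟩ := hy
    exact ⟨max E F, add_mem (energyLE_mono (le_max_left _ _) hx)
      (energyLE_mono (le_max_right _ _) hy)⟩
  | ι_mul x w hx =>
    induction w using Finsupp.induction_linear with
    | zero => exact ⟨0, by simp⟩
    | add f g hf hg =>
      obtain ⟨E, hf⟩ := hf
      obtain ⟨F, hg⟩ := hg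
      refine ⟨max E F, ?_⟩
      rw [map_add, add_mul]
      exact add_mem (energyLE_mono (le_max_left _ _) hf) (energyLE_mono (le_max_right _ _) hg)
    | single n c =>
      obtain ⟨E, hx⟩ := hx
      refine ⟨E + |2 * n + 1|, ?_⟩
      have := Submodule.smul_mem _ c (wedge_mem n hx)
      rwa [wedge_apply, ← smul_mul_assoc, ← map_smul, Finsupp.smul_single, smul_eq_mul,
        mul_one] at this

lemma opH_locally_nilpotent (x y : List k) (v : Fock k) : ∃ j : ℕ, (opH x y ^ j) v = 0 := by
  obtain ⟨E, hv⟩ := exists_mem_energyLE v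
  have key : ∀ j : ℕ, (opH x y ^ j) v ∈ energyLE k (E - 2 * j) := by
    intro j
    induction j with
    | zero => simpa using hv
    | succ j ih =>
      rw [pow_succ', Module.End.mul_apply]
      exact energyLE_mono (by push_cast; omega) (opH_mem x y ih)
  refine ⟨E.toNat + 1, ?_⟩
  have := key (E.toNat + 1)
  rwa [energyLE_neg (by push_cast; omega), Submodule.mem_bot] at this

lemma neg_opH_locally_nilpotent (x y : List k) (v : Fock k) :
    ∃ j : ℕ, ((-opH x y) ^ j) v = 0 := by
  obtain ⟨j, h⟩ := opH_locally_nilpotent x y v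
  refine ⟨j, ?_⟩
  rcases Nat.even_or_odd j with e | e
  · rw [e.neg_pow (opH x y), h]
  · rw [e.neg_pow (opH x y), LinearMap.neg_apply, h, neg_zero]

end Energy

/-- The operator `e^{H(x/y)}`. -/
def expH (x y : List k) : Module.End k (Fock k) := expEnd (opH x y) (opH_locally_nilpotent x y)

/-- The operator `e^{-H(x/y)}`. -/
def expNegH (x y : List k) : Module.End k (Fock k) :=
  expEnd (-opH x y) (neg_opH_locally_nilpotent x y)

/-- The shifted vacuum `|-r⟩ = ψ*_{-r} ⋯ ψ*_{-2} ψ*_{-1} |0⟩`. -/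
def shiftedVac : ℕ → Fock k
  | 0 => vac
  | r + 1 => psiStar (-((r : ℤ) + 1)) (shiftedVac r)

/-- The shifted dual vacuum `⟨-r| = ⟨0| ψ_{-1} ψ_{-2} ⋯ ψ_{-r}`, the transpose of `|-r⟩`. -/
def shiftedBraVac : ℕ → Module.Dual k (Fock k)
  | 0 => braVac
  | r + 1 => shiftedBraVac r ∘ₗ psi (-((r : ℤ) + 1))

/-- The length `ℓ(λ)`, i.e. the number of nonzero parts; a Young diagram is a partition up to
trailing zeros, and `λ.rowLen i` is the part `λ_{i+1}`. -/
def len (lam : YoungDiagram) : ℕ := lam.colLen 0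

/-- The index `λ_{i+1} - (i+1)`, for `i = 0, 1, 2, …`. -/
def modeIdx (lam : YoungDiagram) (i : ℕ) : ℤ := (lam.rowLen i : ℤ) - ((i : ℤ) + 1)

/-- The vector `|λ⟩_{x/y}` attached to two tuples of tuples, computed with `r` factors:
`(e^{H(x⁽¹⁾/y⁽¹⁾)} ψ_{λ₁-1} e^{-H(x⁽¹⁾/y⁽¹⁾)}) ⋯ (e^{H(x⁽ʳ⁾/y⁽ʳ⁾)} ψ_{λ_r-r} e^{-H(x⁽ʳ⁾/y⁽ʳ⁾)}) |-r⟩`. -/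
def multiKet (x y : ℕ → List k) (lam : YoungDiagram) (r : ℕ) : Fock k :=
  (((List.range r).map fun i =>
    expH (x i) (y i) * psi (modeIdx lam i) * expNegH (x i) (y i)).prod : Module.End k (Fock k))
    (shiftedVac r)

/-- The refined tuple `[t] = (t[1], t[2], …)`, with `t[i] = (t_1, …, t_{i-1})`. -/
def refinedTuple (t : ℕ → k) (i : ℕ) : List k := (List.range i).map t

/-- `|λ⟩_{[t]} = ψ_{λ₁-1} e^{H(t₁)} ψ_{λ₂-2} e^{H(t₂)} ⋯ ψ_{λ_r-r} e^{H(t_r)} |-r⟩`. -/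
def refinedKet (t : ℕ → k) (lam : YoungDiagram) (r : ℕ) : Fock k :=
  (((List.range r).map fun i => psi (modeIdx lam i) * expH [t i] []).prod :
    Module.End k (Fock k)) (shiftedVac r)

/-- `_{[t]}⟨μ| = ⟨-r| e^{-H(t_r)} ψ*_{μ_r-r} ⋯ e^{-H(t₂)} ψ*_{μ₂-2} e^{-H(t₁)} ψ*_{μ₁-1}`. -/
def refinedBra (t : ℕ → k) (mu : YoungDiagram) (r : ℕ) : Module.Dual k (Fock k) :=
  shiftedBraVac r ∘ₗ
    ((List.range r).map fun i => expNegH [t i] [] * psiStar (modeIdx mu i)).reverse.prod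

end FreeFermion

end

/-!
The fermionic Fock space is treated through two facts about `H = H(t)`: bracketing with `H` shifts
the index of a fermion, and `H` kills every shifted vacuum `|-r⟩`.

Bracketing.  From `[a_m, ψ_n] = ψ_{n-m}` and `[a_m, ψ*_n] = -ψ*_{n+m}` the bracket with `H(t)` acts on
the family `ψ_n, ψ_{n-1}, …`, indexed by the powers of a formal variable `X`, as multiplication by
`∑ (t^m / m) X^m = -log (1 - t X)`, and so does the bracket with `-H(t)` on `ψ*_n, ψ*_{n+1}, …`.  Since
`exp (-log (1 - t X)) (1 - t X) = 1`, exponentiating (`expEnd_conj`) gives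
`e^{H(t)} (ψ_n - t ψ_{n-1}) = ψ_n e^{H(t)}` and `e^{-H(t)} (ψ*_n - t ψ*_{n+1}) = ψ*_n e^{-H(t)}`.  Power
series multiply commutatively, so the operators `H(x)` commute with each other (`opH_commute`) and
`e^{H(x)}` is multiplicative in `x`; hence the product of the conjugated fermions telescopes to the
product defining `|λ⟩_{[t]}`.

Stability.  An extra factor `ψ_{-r-1} e^{H(t)}` in the ket is absorbed because `e^{H(t)}` fixes
`|-r-1⟩`.  For the bra one needs `⟨-r-1| e^{-H(t)} ψ*_{-r-1} = ⟨-r|`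
(`shiftedBraVac_succ_expNegH_psiStar`), which follows from the characterisation of `⟨-r|` by the
fermions that annihilate it (`eq_smul_shiftedBraVac`).

Orthonormality.  The relations above show that `e^{H(t)}` preserves the condition that `ψ*_n` kills a
vector for all `n > c`, and that passing through `e^{-H(t)}` changes the index of a fermion acting on a
bra by at most one.  As the indices `λ_i - i` and `μ_i - i` decrease strictly, `ψ*_n` kills the part of
the ket from its `i`-th factor on when `n > λ_i - i` (`psiStar_ketTail`), and `ψ_n` kills the
corresponding part of the bra when `n > μ_i - i` (`braTail_psi`).  Therefore
`ψ*_{μ_1-1} ψ_{λ_1-1}` contributes its contraction `δ` only, after which `e^{-H(t_1)} e^{H(t_1)} = 1`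
reduces the pairing to that of the remaining factors (`braTail_ketTail`).
-/

noncomputable section

namespace FreeFermion

variable {k : Type*} [Field k]

open Finset

/-! ### Power series acting on locally finite families of operators -/

section PowerSeriesAction

open PowerSeries

lemma sum_antidiagonal_eq_sum_range {V : Type*} [AddCommMonoid V] (g : ℕ → ℕ → V) {A B : ℕ}
    (hA : ∀ i j, A ≤ i → g i j = 0) (hB : ∀ i j, B ≤ j → g i j = 0) :
    ∑ n ∈ range (A + B), ∑ p ∈ antidiagonal n, g p.1 p.2 =
      ∑ i ∈ range A, ∑ j ∈ range B, g i j := by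
  rw [← sum_product' (range A) (range B) g,
    ← sum_fiberwise_of_maps_to (s := range A ×ˢ range B) (t := range (A + B))
      (g := fun p => p.1 + p.2)]
  · refine sum_congr rfl fun n _ => (sum_subset ?_ ?_).symm
    · intro p hp
      simpa using (mem_filter.1 hp).2
    · intro p hp hp'
      rw [HasAntidiagonal.mem_antidiagonal] at hp
      simp only [mem_filter, mem_product, mem_range, hp, and_true, not_and_or, not_lt] at hp'
      exact hp'.elim (hA _ _) (hB _ _)
  · intro p hp
    simp only [mem_product, mem_range] at hp ⊢
    omega

section Pairing

variable {V : Type*} [AddCommGroup V] [Module k V]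

/-- The value `∑_j f_j w_j` of a formal power series `f` on a sequence `w` of vectors; it is
meaningful when `w` is eventually zero. -/
def pairing (w : ℕ → V) (f : PowerSeries k) : V := ∑ᶠ j, coeff j f • w j

lemma pairing_eq_sum {w : ℕ → V} {N : ℕ} (hw : ∀ j, N ≤ j → w j = 0) (f : PowerSeries k) :
    pairing w f = ∑ j ∈ range N, coeff j f • w j := by
  refine finsum_eq_sum_of_support_subset _ fun j hj => ?_
  rw [coe_range, Set.mem_Iio]
  by_contra h
  exact hj (by simp only [hw j (not_lt.1 h), smul_zero])

lemma pairing_one (w : ℕ → V) : pairing w (1 : PowerSeries k) = w 0 := by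
  rw [pairing, finsum_eq_single _ 0 fun j hj => by rw [coeff_one, if_neg hj, zero_smul]]
  simp

lemma pairing_congr {w : ℕ → V} {N : ℕ} (hw : ∀ j, N ≤ j → w j = 0) {f g : PowerSeries k}
    (h : ∀ j < N, coeff j f = coeff j g) : pairing w f = pairing w g := by
  rw [pairing_eq_sum hw, pairing_eq_sum hw]
  exact sum_congr rfl fun j hj => by rw [h j (mem_range.1 hj)]

lemma pairing_sum_smul {w : ℕ → V} {N : ℕ} (hw : ∀ j, N ≤ j → w j = 0) {ι : Type*}
    (s : Finset ι) (a : ι → k) (f : ι → PowerSeries k) :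
    pairing w (∑ i ∈ s, a i • f i) = ∑ i ∈ s, a i • pairing w (f i) := by
  simp only [pairing_eq_sum hw, map_sum, sum_smul, smul_sum, smul_smul, map_smul, smul_eq_mul]
  exact sum_comm

lemma pairing_one_sub_C_mul_X {w : ℕ → V} {N : ℕ} (hw : ∀ j, N ≤ j → w j = 0) (t : k) :
    pairing w (1 - C t * X) = w 0 - t • w 1 := by
  rw [pairing_eq_sum (N := N + 2) fun j hj => hw j (by omega), sum_range_succ', sum_range_succ']
  have : ∀ j, coeff (j + 1 + 1) (1 - C t * X) = 0 := fun j => by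
    simp [coeff_one, coeff_succ_mul_X]
  simp [this, coeff_one, coeff_succ_mul_X]
  abel

variable {T : Module.End k V} {c : ℕ → Module.End k V} {L : PowerSeries k}

/-- If the commutator of `T` with the `j`-th member of a locally finite family of operators is
`∑_m L_m c_{j+m}`, then the commutator of `T` with the operator `∑_j f_j c_j` is the operator
belonging to the series `L f`. -/
lemma map_pairing (hc : ∀ v, ∃ N, ∀ j, N ≤ j → c j v = 0)
    (hT : ∀ j v, T (c j v) = c j (T v) + pairing (fun i => c (j + i) v) L)
    (f : PowerSeries k) (v : V) :
    T (pairing (fun j => c j v) f) =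
      pairing (fun j => c j (T v)) f + pairing (fun j => c j v) (L * f) := by
  obtain ⟨N, hN⟩ := hc v
  obtain ⟨M, hM⟩ := hc (T v)
  have hv : ∀ j, max N M ≤ j → c j v = 0 := fun j hj => hN j (by omega)
  have hTv : ∀ j, max N M ≤ j → c j (T v) = 0 := fun j hj => hM j (by omega)
  generalize max N M = K at hv hTv
  rw [pairing_eq_sum hv, pairing_eq_sum hTv, map_sum,
    pairing_eq_sum (N := K + K) fun j hj => hv j (by omega)]
  simp only [map_smul, hT, smul_add, sum_add_distrib, coeff_mul, sum_smul]
  congr 1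
  rw [← sum_congr rfl fun n _ => sum_congr rfl fun p hp =>
      congrArg (fun n => (coeff p.1 L * coeff p.2 f) • c n v) (HasAntidiagonal.mem_antidiagonal.1 hp),
    sum_antidiagonal_eq_sum_range (fun i j => (coeff i L * coeff j f) • c (i + j) v)
      (fun i j h => by rw [hv _ (by omega), smul_zero])
      (fun i j h => by rw [hv _ (by omega), smul_zero]), sum_comm]
  refine sum_congr rfl fun j _ => ?_
  rw [pairing_eq_sum (N := K) fun i hi => hv _ (by omega), smul_sum]
  exact sum_congr rfl fun i _ => by rw [smul_smul, mul_comm, add_comm]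

lemma pow_map_pairing (hc : ∀ v, ∃ N, ∀ j, N ≤ j → c j v = 0)
    (hT : ∀ j v, T (c j v) = c j (T v) + pairing (fun i => c (j + i) v) L)
    (f : PowerSeries k) (v : V) (n : ℕ) :
    (T ^ n) (pairing (fun j => c j v) f) =
      ∑ p ∈ antidiagonal n,
        n.choose p.1 • pairing (fun j => c j ((T ^ p.2) v)) (L ^ p.1 * f) := by
  induction n with
  | zero => simp
  | succ n ih =>
    rw [sum_antidiagonal_choose_succ_nsmul
      (fun a b => pairing (fun j => c j ((T ^ b) v)) (L ^ a * f)), pow_succ',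
      Module.End.mul_apply, ih, map_sum, ← sum_add_distrib]
    refine sum_congr rfl fun p hp => ?_
    rw [map_nsmul, map_pairing hc hT, nsmul_add, pow_succ', pow_succ', mul_assoc,
      Nat.choose_symm_of_eq_add (HasAntidiagonal.mem_antidiagonal.1 hp).symm, Module.End.mul_apply]

/-- The commutator of two operators acting on the family through power series commutes with the
family, because multiplication of power series is commutative. -/
lemma commutator_apply {T' : Module.End k V} {L' : PowerSeries k}
    (hc : ∀ v, ∃ N, ∀ j, N ≤ j → c j v = 0)
    (hT : ∀ j v, T (c j v) = c j (T v) + pairing (fun i => c (j + i) v) L)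
    (hT' : ∀ j v, T' (c j v) = c j (T' v) + pairing (fun i => c (j + i) v) L') (v : V) :
    (T * T' - T' * T) (c 0 v) = c 0 ((T * T' - T' * T) v) := by
  have h := hT 0
  have h' := hT' 0
  simp only [zero_add] at h h'
  simp only [LinearMap.sub_apply, Module.End.mul_apply, h, h', map_add, map_sub,
    map_pairing hc hT, map_pairing hc hT', mul_comm L L']
  abel

end Pairing

/-! ### The series `-log (1 - t X)` and its exponential -/

section ExpLog

/-- The series `∑_{n > 0} (p_n(x/y) / n) X^n`; its constant coefficient, a division by zero, is `0`. -/
def logSeries (x y : List k) : PowerSeries k := mk fun n => powerSum x y n / (n : k)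

lemma constantCoeff_logSeries (x y : List k) : constantCoeff (logSeries x y) = 0 := by
  simp [logSeries, ← coeff_zero_eq_constantCoeff_apply]

/-- The series `∑ (t^n/n) X^n` is `-log (1 - t X)`, in differentiated form. -/
lemma derivative_logSeries_mul [CharZero k] (t : k) :
    derivative k (logSeries [t] []) * (1 - C t * X) = C t := by
  have h : derivative k (logSeries [t] []) = mk fun n => t ^ (n + 1) := by
    ext n
    have : ((n : k) + 1) ≠ 0 := by exact_mod_cast n.succ_ne_zero
    rw [coeff_derivative]
    simp [logSeries, powerSum]
    field_simp
  rw [h, mul_sub, mul_one, mul_left_comm]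
  ext (_ | n)
  · simp [coeff_C]
  · simp [coeff_succ_mul_X]
    ring

/-- `exp (-log (1 - t X)) (1 - t X) = 1` with the exponential truncated after `N` terms, modulo
`X ^ (N + 1)`. -/
lemma coeff_truncated_exp_mul [CharZero k] (t : k) (N : ℕ) {j : ℕ} (hj : j < N + 1) :
    coeff j ((∑ i ∈ range (N + 1), ((i.factorial : k)⁻¹) • logSeries [t] [] ^ i) *
      (1 - C t * X)) = coeff j 1 := by
  set L := logSeries [t] [] with hL
  have hL0 : constantCoeff L = 0 := constantCoeff_logSeries _ _
  obtain _ | j := j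
  · rw [sum_range_succ']
    simp [hL0]
  set G := ∑ i ∈ range (N + 1), ((i.factorial : k)⁻¹) • L ^ i with hG
  set R := ((N.factorial : k)⁻¹) • L ^ N with hR
  have hd : derivative k G = derivative k L * (G - R) := by
    have h1 : G - R = ∑ i ∈ range N, ((i.factorial : k)⁻¹) • L ^ i := by
      rw [hG, hR, sum_range_succ, add_sub_cancel_right]
    rw [h1, hG, sum_range_succ', map_add, mul_sum, map_sum, pow_zero, Derivation.map_smul,
      Derivation.map_one_eq_zero, smul_zero, add_zero]
    refine sum_congr rfl fun i _ => ?_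
    have : ((i : k) + 1) ≠ 0 := by exact_mod_cast i.succ_ne_zero
    rw [Derivation.map_smul, Derivation.leibniz_pow, Nat.add_sub_cancel, Nat.factorial_succ,
      smul_eq_mul, ← Nat.cast_smul_eq_nsmul k, smul_smul, mul_smul_comm, mul_comm (L ^ i)]
    congr 1
    push_cast
    field_simp
  have hP : derivative k (G * (1 - C t * X)) = -(C t * R) := by
    have h1 : derivative k (1 - C t * X) = -C t := by
      simp [Derivation.leibniz]
    rw [Derivation.leibniz, h1, hd, smul_eq_mul, smul_eq_mul]
    linear_combination (G - R) * derivative_logSeries_mul t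
  have hR0 : coeff j (C t * R) = 0 := by
    rw [hR, coeff_C_mul, map_smul,
      X_pow_dvd_iff.1 (pow_dvd_pow_of_dvd (X_dvd_iff.2 hL0) N) j (by omega), smul_zero, mul_zero]
  have h := congrArg (coeff j) hP
  rw [coeff_derivative, map_neg, hR0, neg_zero] at h
  have : ((j : k) + 1) ≠ 0 := by exact_mod_cast j.succ_ne_zero
  simpa [coeff_one] using (mul_eq_zero.1 h).resolve_right this

end ExpLog

/-! ### Exponentials of locally nilpotent operators -/

section Exponential

variable {T S : Module.End k (Fock k)}

lemma expEnd_apply (hT : ∀ v, ∃ j : ℕ, (T ^ j) v = 0) {v : Fock k} {N : ℕ}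
    (hN : ∀ j, N ≤ j → (T ^ j) v = 0) :
    expEnd T hT v = ∑ j ∈ range N, ((j.factorial : k)⁻¹) • (T ^ j) v := by
  refine finsum_eq_sum_of_support_subset _ fun j hj => ?_
  rw [coe_range, Set.mem_Iio]
  by_contra h
  exact hj (by simp only [LinearMap.smul_apply, hN j (not_lt.1 h), smul_zero])

lemma exists_forall_pow_apply_eq_zero (hT : ∀ v, ∃ j : ℕ, (T ^ j) v = 0) (v : Fock k) :
    ∃ N, ∀ j, N ≤ j → (T ^ j) v = 0 := by
  obtain ⟨N, hN⟩ := hT v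
  refine ⟨N, fun j hj => ?_⟩
  obtain ⟨d, rfl⟩ := Nat.exists_eq_add_of_le' hj
  rw [pow_add, Module.End.mul_apply, hN, map_zero]

lemma expEnd_apply_eq_self (hT : ∀ v, ∃ j : ℕ, (T ^ j) v = 0) {v : Fock k} (hv : T v = 0) :
    expEnd T hT v = v := by
  rw [expEnd_apply hT (N := 1) fun j hj => ?_]
  · simp
  · obtain ⟨d, rfl⟩ := Nat.exists_eq_add_of_le' hj
    rw [pow_succ, Module.End.mul_apply, hv, map_zero]

/-- If the `n`-th powers of `T` expand binomially on a vector `w`, then the exponential series of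
`T` on `w` is a finite double sum. -/
lemma expEnd_apply_of_binomial [CharZero k] (hT : ∀ v, ∃ j : ℕ, (T ^ j) v = 0) {w : Fock k}
    (g : ℕ → ℕ → Fock k) (hg : ∀ n, (T ^ n) w = ∑ p ∈ antidiagonal n, n.choose p.1 • g p.1 p.2)
    {A B : ℕ} (hA : ∀ i j, A ≤ i → g i j = 0) (hB : ∀ i j, B ≤ j → g i j = 0) :
    expEnd T hT w = ∑ i ∈ range A, ∑ j ∈ range B,
      ((i.factorial : k)⁻¹ * (j.factorial : k)⁻¹) • g i j := by
  rw [expEnd_apply hT (N := A + B), ← sum_antidiagonal_eq_sum_range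
    (fun i j => ((i.factorial : k)⁻¹ * (j.factorial : k)⁻¹) • g i j)
    (fun i j h => by rw [hA i j h, smul_zero]) (fun i j h => by rw [hB i j h, smul_zero])]
  · refine sum_congr rfl fun n _ => ?_
    rw [hg, smul_sum]
    refine sum_congr rfl fun p hp => ?_
    obtain rfl := HasAntidiagonal.mem_antidiagonal.1 hp
    have h0 : ∀ n : ℕ, (n.factorial : k) ≠ 0 := fun n => by exact_mod_cast n.factorial_ne_zero
    have h1 := h0 p.1
    have h2 := h0 p.2
    have h3 := h0 (p.1 + p.2)
    rw [← Nat.cast_smul_eq_nsmul k, smul_smul]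
    congr 1
    have := congrArg (Nat.cast (R := k)) (Nat.add_choose_mul_factorial_mul_factorial p.1 p.2)
    rw [← Nat.choose_symm_add] at this
    push_cast at this
    field_simp
    linear_combination this
  · intro n hn
    rw [hg]
    refine sum_eq_zero fun p hp => ?_
    have := HasAntidiagonal.mem_antidiagonal.1 hp
    rcases le_or_gt A p.1 with h | h
    · rw [hA _ _ h, smul_zero]
    · rw [hB _ _ (by omega), smul_zero]

lemma expEnd_add [CharZero k] (h : Commute T S) (hT : ∀ v, ∃ j : ℕ, (T ^ j) v = 0)
    (hS : ∀ v, ∃ j : ℕ, (S ^ j) v = 0) (hTS : ∀ v, ∃ j : ℕ, ((T + S) ^ j) v = 0) :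
    expEnd (T + S) hTS = expEnd T hT * expEnd S hS := by
  refine LinearMap.ext fun v => ?_
  obtain ⟨A, hA⟩ := exists_forall_pow_apply_eq_zero hT v
  obtain ⟨B, hB⟩ := exists_forall_pow_apply_eq_zero hS v
  have hc : ∀ i j, (T ^ i) ((S ^ j) v) = (S ^ j) ((T ^ i) v) := fun i j =>
    LinearMap.congr_fun (h.pow_pow i j).eq v
  rw [expEnd_apply_of_binomial hTS (fun i j => (T ^ i) ((S ^ j) v)) (A := A) (B := B),
    Module.End.mul_apply, expEnd_apply hS hB, map_sum, sum_comm]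
  · refine sum_congr rfl fun j _ => ?_
    rw [map_smul, expEnd_apply hT (N := A) fun i hi => by rw [hc, hA i hi, map_zero], smul_sum]
    exact sum_congr rfl fun i _ => by rw [smul_smul, mul_comm]
  · intro n
    rw [h.add_pow']
    simp
  · intro i j hi
    rw [hc, hA i hi, map_zero]
  · intro i j hj
    rw [hB j hj, map_zero]

/-- Conjugation by an exponential: if bracketing with `T` acts on the family `c` as multiplication
by `-log (1 - t X)` acts on the powers of `X`, then conjugation by `e^T` acts as multiplication by
`(1 - t X)⁻¹`. -/
lemma expEnd_conj [CharZero k] (hT : ∀ v, ∃ j : ℕ, (T ^ j) v = 0) {c : ℕ → Module.End k (Fock k)}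
    {t : k} (hc : ∀ v, ∃ N, ∀ j, N ≤ j → c j v = 0)
    (hTc : ∀ j v, T (c j v) = c j (T v) + pairing (fun i => c (j + i) v) (logSeries [t] [])) :
    expEnd T hT * (c 0 - t • c 1) = c 0 * expEnd T hT := by
  refine LinearMap.ext fun v => ?_
  obtain ⟨B, hB⟩ := exists_forall_pow_apply_eq_zero hT v
  choose N hN using hc
  -- from the index `A + 1` on the family kills all of the finitely many vectors `T ^ l v`
  obtain ⟨A, hA⟩ : ∃ A, ∀ l j, A + 1 ≤ j → c j ((T ^ l) v) = 0 := by
    refine ⟨(range B).sup fun l => N ((T ^ l) v), fun l j hj => ?_⟩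
    rcases lt_or_ge l B with hl | hl
    · have := le_sup (f := fun l => N ((T ^ l) v)) (mem_range.2 hl)
      exact hN _ _ (this.trans (Nat.le_of_succ_le hj))
    · rw [hB l hl, map_zero]
  have hL : ∀ i j, j < i → coeff j (logSeries [t] [] ^ i) = 0 := fun i j hj =>
    X_pow_dvd_iff.1 (pow_dvd_pow_of_dvd (X_dvd_iff.2 (constantCoeff_logSeries [t] [])) i) j hj
  have h0 := pairing_one_sub_C_mul_X (fun j hj => by simpa using hA 0 j hj) t
  rw [Module.End.mul_apply, Module.End.mul_apply, LinearMap.sub_apply, LinearMap.smul_apply, ← h0,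
    expEnd_apply_of_binomial hT
      (fun i j => pairing (fun l => c l ((T ^ j) v)) (logSeries [t] [] ^ i * (1 - C t * X)))
      (A := A + 1) (B := B), sum_comm, expEnd_apply hT hB, map_sum]
  · refine sum_congr rfl fun l _ => ?_
    simp only [mul_comm _ ((l.factorial : k)⁻¹), mul_smul]
    rw [← smul_sum, ← pairing_sum_smul (hA l), map_smul]
    congr 1
    rw [pairing_congr (hA l) (g := 1), pairing_one]
    intro j hj
    rw [← coeff_truncated_exp_mul t A hj, sum_mul]
    simp only [smul_mul_assoc]
  · exact pow_map_pairing (fun v => ⟨N v, hN v⟩) hTc _ v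
  · intro i j hi
    rw [pairing_congr (hA j) (g := 0), pairing_eq_sum (hA j)]
    · simp
    · intro l hl
      exact X_pow_dvd_iff.1 (Dvd.dvd.mul_right (X_pow_dvd_iff.2 fun m hm => hL i m hm) _) l
        (by omega)
  · intro i j hj
    simp [hB j hj, pairing]

end Exponential

end PowerSeriesAction

/-! ### Brackets of the Heisenberg operators with the fermions -/

section Commutators

lemma psi_psi (m n : ℤ) (v : Fock k) : psi m (psi n v) = -psi n (psi m v) :=
  eq_neg_of_add_eq_zero_left (LinearMap.congr_fun (psi_anticomm m n) v)

lemma psiStar_psiStar (m n : ℤ) (v : Fock k) :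
    psiStar m (psiStar n v) = -psiStar n (psiStar m v) :=
  eq_neg_of_add_eq_zero_left (LinearMap.congr_fun (psiStar_anticomm m n) v)

lemma psiStar_psi (m n : ℤ) (v : Fock k) :
    psiStar m (psi n v) = (if n = m then v else 0) - psi n (psiStar m v) := by
  rw [psi_psiStar_apply, sub_sub_cancel]

lemma heis_apply {m : ℤ} (hm : m ≠ 0) (v : Fock k) :
    heis m v = ∑ᶠ i : ℤ, psi i (psiStar (i + m) v) :=
  finsum_congr fun i => by
    change normalOrd i (i + m) v = _
    rw [normalOrd_of_ne (by omega)]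
    rfl

lemma finite_support_psi_psiStar {m : ℤ} (hm : m ≠ 0) (v : Fock k) :
    (Function.support fun i : ℤ => psi i (psiStar (i + m) v)).Finite := by
  refine (normalOrd_support m v).subset fun i hi => ?_
  rw [Function.mem_support, normalOrd_of_ne (by omega)]
  exact hi

lemma map_finsum_psi_psiStar {m : ℤ} (hm : m ≠ 0) (A : Module.End k (Fock k)) (v : Fock k) :
    A (heis m v) = ∑ᶠ i : ℤ, A (psi i (psiStar (i + m) v)) := by
  rw [heis_apply hm]
  exact A.toAddMonoidHom.map_finsum (finite_support_psi_psiStar hm v)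

lemma finite_support_map {m : ℤ} (hm : m ≠ 0) (A : Module.End k (Fock k)) (v : Fock k) :
    (Function.support fun i : ℤ => A (psi i (psiStar (i + m) v))).Finite :=
  (finite_support_psi_psiStar hm v).subset fun i hi h => hi (by simp only [h, map_zero])

/-- `[a_m, ψ_n] = ψ_{n-m}` for `m ≠ 0`. -/
lemma heis_psi {m : ℤ} (hm : m ≠ 0) (n : ℤ) (v : Fock k) :
    heis m (psi n v) = psi n (heis m v) + psi (n - m) v := by
  have h : ∀ i : ℤ, psi i (psiStar (i + m) (psi n v)) =
      psi n (psi i (psiStar (i + m) v)) + (if i = n - m then psi i v else 0) := by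
    intro i
    rw [psiStar_psi, map_sub, psi_psi i n, sub_neg_eq_add, add_comm]
    congr 1
    by_cases hi : i = n - m
    · rw [if_pos hi, if_pos (by omega)]
    · rw [if_neg hi, if_neg (by omega), map_zero]
  rw [heis_apply hm, finsum_congr h, finsum_add_distrib (finite_support_map hm _ v)
    ((Set.finite_singleton (n - m)).subset fun i hi => by
      by_contra h; exact hi (if_neg h)), map_finsum_psi_psiStar hm,
    finsum_eq_single _ (n - m) fun i hi => if_neg hi, if_pos rfl]

/-- `[a_m, ψ*_n] = -ψ*_{n+m}` for `m ≠ 0`. -/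
lemma heis_psiStar {m : ℤ} (hm : m ≠ 0) (n : ℤ) (v : Fock k) :
    heis m (psiStar n v) = psiStar n (heis m v) - psiStar (n + m) v := by
  have h : ∀ i : ℤ, psi i (psiStar (i + m) (psiStar n v)) =
      psiStar n (psi i (psiStar (i + m) v)) + (if i = n then -psiStar (i + m) v else 0) := by
    intro i
    rw [psiStar_psiStar, map_neg, psi_psiStar_apply]
    split_ifs <;> abel
  rw [heis_apply hm, finsum_congr h, finsum_add_distrib (finite_support_map hm _ v)
    ((Set.finite_singleton n).subset fun i hi => by
      by_contra h; exact hi (if_neg h)), map_finsum_psi_psiStar hm,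
    finsum_eq_single _ n fun i hi => if_neg hi, if_pos rfl, sub_eq_add_neg]

lemma heis_vac {m : ℤ} (hm : 0 < m) : heis m (vac : Fock k) = 0 := by
  rw [heis_apply hm.ne', ← finsum_zero (α := ℤ) (M := Fock k)]
  refine finsum_congr fun i => ?_
  rcases le_or_gt 0 (i + m) with h | h
  · rw [psiStar_vac h, map_zero]
  · rw [psi_psiStar_apply, if_neg (by omega), psi_vac (by omega), map_zero, sub_zero]

lemma exists_forall_psi_eq_zero (n : ℤ) (v : Fock k) :
    ∃ N : ℕ, ∀ j : ℕ, N ≤ j → psi (n - j) v = 0 := by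
  obtain ⟨N, hN, h⟩ := eventually_annihilated v
  refine ⟨(N + n).toNat, fun j hj => ?_⟩
  rw [show n - (j : ℤ) = -(j - n) by ring]
  exact (h _ (by omega)).2

lemma exists_forall_psiStar_eq_zero (n : ℤ) (v : Fock k) :
    ∃ N : ℕ, ∀ j : ℕ, N ≤ j → psiStar (n + j) v = 0 := by
  obtain ⟨N, hN, h⟩ := eventually_annihilated v
  exact ⟨(N - n).toNat, fun j hj => (h _ (by omega)).1⟩

lemma opH_apply (x y : List k) {v : Fock k} {N : ℕ}
    (hN : ∀ n : ℕ, N ≤ n → heis ((n + 1 : ℕ) : ℤ) v = 0) :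
    opH x y v = ∑ n ∈ range N, (powerSum x y (n + 1) / ((n + 1 : ℕ) : k)) •
      heis ((n + 1 : ℕ) : ℤ) v := by
  refine finsum_eq_sum_of_support_subset _ fun j hj => ?_
  rw [coe_range, Set.mem_Iio]
  by_contra h
  exact hj (by simp only [LinearMap.smul_apply, hN j (not_lt.1 h), smul_zero])

lemma exists_forall_heis_eq_zero (v : Fock k) :
    ∃ N : ℕ, ∀ n : ℕ, N ≤ n → heis ((n + 1 : ℕ) : ℤ) v = 0 := by
  obtain ⟨N, h⟩ := heis_eventually_zero v
  exact ⟨N.toNat, fun n hn => h _ (by omega)⟩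

lemma pairing_logSeries (x y : List k) {w : ℕ → Fock k} {N : ℕ}
    (hw : ∀ j, N + 1 ≤ j → w j = 0) :
    pairing w (logSeries x y) =
      ∑ n ∈ range N, (powerSum x y (n + 1) / ((n + 1 : ℕ) : k)) • w (n + 1) := by
  rw [pairing_eq_sum hw, sum_range_succ']
  simp [logSeries]

/-- If every `a_m` with `m > 0` has bracket `c_m` with `A`, then `H(x/y)` has the bracket
`∑_m (p_m(x/y) / m) c_m` with `A`. -/
lemma opH_bracket (x y : List k) (A : Module.End k (Fock k)) {c : ℕ → Module.End k (Fock k)}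
    (hc : ∀ v, ∃ N, ∀ j, N ≤ j → c j v = 0)
    (h : ∀ (n : ℕ) v, heis ((n + 1 : ℕ) : ℤ) (A v) =
      A (heis ((n + 1 : ℕ) : ℤ) v) + c (n + 1) v) (v : Fock k) :
    opH x y (A v) = A (opH x y v) + pairing (fun j => c j v) (logSeries x y) := by
  obtain ⟨N₁, h₁⟩ := hc v
  obtain ⟨N₂, h₂⟩ := exists_forall_heis_eq_zero v
  obtain ⟨N₃, h₃⟩ := exists_forall_heis_eq_zero (A v)
  rw [opH_apply x y (N := N₁ + N₂ + N₃) fun n hn => h₃ n (by omega),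
    opH_apply x y (N := N₁ + N₂ + N₃) fun n hn => h₂ n (by omega),
    pairing_logSeries x y (N := N₁ + N₂ + N₃) fun n hn => h₁ n (by omega), map_sum,
    ← sum_add_distrib]
  exact sum_congr rfl fun n _ => by rw [h, smul_add, map_smul]

lemma opH_psi (x y : List k) (n : ℤ) (v : Fock k) :
    opH x y (psi n v) =
      psi n (opH x y v) + pairing (fun j : ℕ => psi (n - j) v) (logSeries x y) :=
  opH_bracket x y (psi n) (c := fun j : ℕ => psi (n - j)) (exists_forall_psi_eq_zero n)
    (fun m v => heis_psi (by omega) n v) v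

lemma neg_opH_psiStar (x y : List k) (n : ℤ) (v : Fock k) :
    (-opH x y) (psiStar n v) =
      psiStar n ((-opH x y) v) + pairing (fun j : ℕ => psiStar (n + j) v) (logSeries x y) := by
  have h := opH_bracket x y (psiStar n) (c := fun j : ℕ => -psiStar (n + j))
    (fun v => by simpa using exists_forall_psiStar_eq_zero n v)
    (fun m v => (heis_psiStar (by omega) n v).trans (sub_eq_add_neg _ _)) v
  rw [LinearMap.neg_apply, LinearMap.neg_apply, h, map_neg, neg_add, add_right_inj]
  simp only [pairing, LinearMap.neg_apply, smul_neg, finsum_neg_distrib, neg_neg]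

lemma opH_family_psi (x y : List k) (n : ℤ) (j : ℕ) (v : Fock k) :
    opH x y (psi (n - j) v) =
      psi (n - j) (opH x y v) +
        pairing (fun i : ℕ => psi (n - (j + i : ℕ)) v) (logSeries x y) := by
  rw [opH_psi]
  simp only [Nat.cast_add, sub_sub]

lemma neg_opH_family_psiStar (x y : List k) (n : ℤ) (j : ℕ) (v : Fock k) :
    (-opH x y) (psiStar (n + j) v) =
      psiStar (n + j) ((-opH x y) v) +
        pairing (fun i : ℕ => psiStar (n + (j + i : ℕ)) v) (logSeries x y) := by
  rw [neg_opH_psiStar]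
  simp only [Nat.cast_add, add_assoc]

lemma opH_vac (x y : List k) : opH x y (vac : Fock k) = 0 := by
  rw [opH_apply x y (N := 0) fun n _ => heis_vac (by omega), sum_range_zero]

/-- The fermions generate the Fock space from the vacuum, so an operator that commutes with all of
them and kills the vacuum is zero. -/
lemma eq_zero_of_commute {D : Module.End k (Fock k)} (hψ : ∀ n v, D (psi n v) = psi n (D v))
    (hψ' : ∀ n v, D (psiStar n v) = psiStar n (D v)) (hvac : D vac = 0) : D = 0 := by
  refine LinearMap.ext fun v => ?_
  rw [LinearMap.zero_apply]
  induction v using CliffordAlgebra.left_induction with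
  | algebraMap c =>
    rw [Algebra.algebraMap_eq_smul_one, map_smul]
    exact (congrArg (c • ·) hvac).trans (smul_zero c)
  | add x y hx hy => rw [map_add, hx, hy, add_zero]
  | ι_mul x w hx =>
    have hw : ∀ n, D (wedge n x) = 0 := by
      intro n
      rcases le_or_gt 0 n with hn | hn
      · have := hψ n x
        rwa [psi, if_pos hn, hx, map_zero] at this
      · have := hψ' n x
        rwa [psiStar, if_neg (by omega), hx, map_zero] at this
    induction w using Finsupp.induction_linear with
    | zero => simp
    | add f g hf hg => rw [map_add, add_mul, map_add, hf, hg, add_zero]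
    | single n c =>
      have h : D (c • wedge n x) = 0 := by rw [map_smul, hw, smul_zero]
      rwa [wedge_apply, ← smul_mul_assoc, ← map_smul, Finsupp.smul_single, smul_eq_mul,
        mul_one] at h

lemma opH_commute (x y x' y' : List k) : Commute (opH x y) (opH x' y') := by
  refine sub_eq_zero.1 (eq_zero_of_commute (fun n v => ?_) (fun n v => ?_) ?_)
  · simpa using commutator_apply (exists_forall_psi_eq_zero n) (opH_family_psi x y n)
      (opH_family_psi x' y' n) v
  · simpa using commutator_apply (exists_forall_psiStar_eq_zero n) (neg_opH_family_psiStar x y n)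
      (neg_opH_family_psiStar x' y' n) v
  · simp [opH_vac]

lemma opH_append (x x' y y' : List k) : opH (x ++ x') (y ++ y') = opH x y + opH x' y' := by
  refine LinearMap.ext fun v => ?_
  obtain ⟨N, hN⟩ := exists_forall_heis_eq_zero v
  rw [LinearMap.add_apply, opH_apply _ _ hN, opH_apply _ _ hN, opH_apply _ _ hN,
    ← sum_add_distrib]
  refine sum_congr rfl fun n _ => ?_
  rw [← add_smul]
  congr 1
  simp only [powerSum, List.map_append, List.sum_append]
  ring

end Commutators

/-! ### Conjugation of the fermions by `e^{H(x)}` -/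

section VertexOperators

lemma expH_nil : expH ([] : List k) [] = 1 := by
  refine LinearMap.ext fun v => expEnd_apply_eq_self _ ?_
  obtain ⟨N, hN⟩ := exists_forall_heis_eq_zero v
  rw [opH_apply _ _ hN]
  simp [powerSum]

variable [CharZero k]

lemma expH_mul_expNegH (x y : List k) : expH x y * expNegH x y = 1 := by
  have hn : ∀ v, ∃ j : ℕ, ((opH x y + -opH x y) ^ j) v = 0 := fun v => ⟨1, by simp⟩
  rw [expH, expNegH, ← expEnd_add (Commute.refl (opH x y)).neg_right _ _ hn]
  exact LinearMap.ext fun v => expEnd_apply_eq_self hn (by simp)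

lemma expNegH_mul_expH (x y : List k) : expNegH x y * expH x y = 1 := by
  have hn : ∀ v, ∃ j : ℕ, ((-opH x y + opH x y) ^ j) v = 0 := fun v => ⟨1, by simp⟩
  rw [expH, expNegH, ← expEnd_add (Commute.refl (opH x y)).neg_left _ _ hn]
  exact LinearMap.ext fun v => expEnd_apply_eq_self hn (by simp)

lemma expH_append (x x' y y' : List k) :
    expH (x ++ x') (y ++ y') = expH x y * expH x' y' := by
  simp only [expH]
  rw [← expEnd_add (opH_commute x y x' y') _ _
    (by rw [← opH_append]; exact opH_locally_nilpotent _ _)]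
  simp only [opH_append]

/-- `e^{H(t)} (ψ_n - t ψ_{n-1}) e^{-H(t)} = ψ_n`. -/
lemma expH_mul_psi (t : k) (n : ℤ) :
    expH [t] [] * (psi n - t • psi (n - 1)) = psi n * expH [t] [] := by
  simpa [expH] using expEnd_conj (opH_locally_nilpotent [t] []) (exists_forall_psi_eq_zero n)
    (opH_family_psi [t] [] n)

/-- `e^{-H(t)} (ψ*_n - t ψ*_{n+1}) e^{H(t)} = ψ*_n`. -/
lemma expNegH_mul_psiStar (t : k) (n : ℤ) :
    expNegH [t] [] * (psiStar n - t • psiStar (n + 1)) = psiStar n * expNegH [t] [] := by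
  simpa [expNegH] using expEnd_conj (neg_opH_locally_nilpotent [t] [])
    (exists_forall_psiStar_eq_zero n) (neg_opH_family_psiStar [t] [] n)

lemma expNegH_psi (t : k) (n : ℤ) (v : Fock k) :
    expNegH [t] [] (psi n v) =
      psi n (expNegH [t] [] v) - t • psi (n - 1) (expNegH [t] [] v) := by
  have h := congrArg (fun A => expNegH [t] [] * A * expNegH [t] []) (expH_mul_psi t n)
  simp only [← mul_assoc, expNegH_mul_expH, one_mul] at h
  rw [mul_assoc _ (expH _ _), expH_mul_expNegH, mul_one] at h
  exact (LinearMap.congr_fun h v).symm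

lemma expH_psiStar (t : k) (n : ℤ) (v : Fock k) :
    expH [t] [] (psiStar n v) =
      psiStar n (expH [t] [] v) - t • psiStar (n + 1) (expH [t] [] v) := by
  have h := congrArg (fun A => expH [t] [] * A * expH [t] []) (expNegH_mul_psiStar t n)
  simp only [← mul_assoc, expH_mul_expNegH, one_mul] at h
  rw [mul_assoc _ (expNegH _ _), expNegH_mul_expH, mul_one] at h
  exact (LinearMap.congr_fun h v).symm

end VertexOperators

/-! ### Shifted vacua and dual vacua -/

section ShiftedVacua

lemma psi_shiftedVac {r : ℕ} {n : ℤ} (hn : n < -(r : ℤ)) :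
    psi n (shiftedVac r : Fock k) = 0 := by
  induction r with
  | zero => exact psi_vac (by simpa using hn)
  | succ r ih =>
    push_cast at hn
    rw [shiftedVac, psi_psiStar_apply, if_neg (by omega), ih (by omega), map_zero, sub_zero]

lemma psi_shiftedVac_succ (r : ℕ) :
    psi (-((r : ℤ) + 1)) (shiftedVac (r + 1) : Fock k) = shiftedVac r := by
  rw [shiftedVac, psi_psiStar_apply, if_pos rfl, psi_shiftedVac (by omega), map_zero, sub_zero]

lemma shiftedBraVac_psiStar {r : ℕ} {n : ℤ} (hn : n < -(r : ℤ)) (v : Fock k) :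
    shiftedBraVac r (psiStar n v) = 0 := by
  induction r generalizing v with
  | zero => exact LinearMap.congr_fun (braVac_psiStar (by simpa using hn)) v
  | succ r ih =>
    push_cast at hn
    rw [shiftedBraVac, LinearMap.comp_apply, psi_psiStar_apply, if_neg (by omega), zero_sub,
      map_neg, ih (by omega), neg_zero]

lemma shiftedBraVac_shiftedVac (r : ℕ) : shiftedBraVac r (shiftedVac r : Fock k) = 1 := by
  induction r with
  | zero => exact braVac_vac
  | succ r ih => rw [shiftedBraVac, LinearMap.comp_apply, psi_shiftedVac_succ, ih]

lemma eq_smul_braVac {f : Module.Dual k (Fock k)} (hf : ∀ n v, f (wedge n v) = 0) :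
    f = f vac • braVac := by
  refine LinearMap.ext fun v => ?_
  rw [LinearMap.smul_apply]
  induction v using CliffordAlgebra.left_induction with
  | algebraMap c =>
    rw [Algebra.algebraMap_eq_smul_one, map_smul, map_smul]
    change c • f vac = f vac • c • braVac (vac : Fock k)
    rw [braVac_vac, smul_eq_mul, smul_eq_mul, smul_eq_mul]
    ring
  | add x y hx hy => rw [map_add, map_add, hx, hy, smul_add]
  | ι_mul x w hx =>
    clear hx
    induction w using Finsupp.induction_linear with
    | zero => simp
    | add g h hg hh => rw [map_add, add_mul, map_add, map_add, hg, hh, smul_add]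
    | single n c =>
      have h : f (c • wedge n x) = f vac • braVac (c • wedge n x) := by
        rw [map_smul, map_smul, hf, braVac_wedge, smul_zero, smul_zero]
      rwa [wedge_apply, ← smul_mul_assoc, ← map_smul, Finsupp.smul_single, smul_eq_mul,
        mul_one] at h

variable [CharZero k]

lemma psi_psi_self (n : ℤ) (v : Fock k) : psi n (psi n v) = 0 := by
  have h : (2 : k) • psi n (psi n v) = 0 := by
    rw [two_smul]
    exact add_eq_zero_iff_eq_neg.2 (psi_psi n n v)
  exact (smul_eq_zero.1 h).resolve_left two_ne_zero

lemma psiStar_psiStar_self (n : ℤ) (v : Fock k) : psiStar n (psiStar n v) = 0 := by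
  have h : (2 : k) • psiStar n (psiStar n v) = 0 := by
    rw [two_smul]
    exact add_eq_zero_iff_eq_neg.2 (psiStar_psiStar n n v)
  exact (smul_eq_zero.1 h).resolve_left two_ne_zero

lemma psiStar_shiftedVac {r : ℕ} {n : ℤ} (hn : -(r : ℤ) ≤ n) :
    psiStar n (shiftedVac r : Fock k) = 0 := by
  induction r with
  | zero => exact psiStar_vac (by simpa using hn)
  | succ r ih =>
    rw [shiftedVac]
    rcases eq_or_ne n (-((r : ℤ) + 1)) with rfl | h
    · exact psiStar_psiStar_self _ _
    · rw [psiStar_psiStar, ih (by push_cast at hn; omega), map_zero, neg_zero]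

lemma shiftedBraVac_psi {r : ℕ} {n : ℤ} (hn : -(r : ℤ) ≤ n) (v : Fock k) :
    shiftedBraVac r (psi n v) = 0 := by
  induction r generalizing v with
  | zero => exact LinearMap.congr_fun (braVac_psi (by simpa using hn)) v
  | succ r ih =>
    rw [shiftedBraVac, LinearMap.comp_apply]
    rcases eq_or_ne n (-((r : ℤ) + 1)) with rfl | h
    · rw [psi_psi_self, map_zero]
    · rw [psi_psi, map_neg, ih (by push_cast at hn; omega), neg_zero]

/-- Up to a scalar, `⟨-r|` is the only bra killed by `ψ_n`, `n ≥ -r`, and `ψ*_n`, `n < -r`. -/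
lemma eq_smul_shiftedBraVac {r : ℕ} {f : Module.Dual k (Fock k)}
    (hψ : ∀ n, -(r : ℤ) ≤ n → ∀ v, f (psi n v) = 0)
    (hψ' : ∀ n, n < -(r : ℤ) → ∀ v, f (psiStar n v) = 0) :
    f = f (shiftedVac r) • shiftedBraVac r := by
  induction r generalizing f with
  | zero =>
    refine eq_smul_braVac fun n v => ?_
    rcases le_or_gt 0 n with hn | hn
    · have := hψ n (by simpa using hn) v
      rwa [psi, if_pos hn] at this
    · have := hψ' n (by simpa using hn) v
      rwa [psiStar, if_neg (by omega)] at this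
  | succ r ih =>
    push_cast at hψ hψ'
    -- `f ψ*_{-r-1}` satisfies the conditions for `r`, and `f` is recovered from it by `ψ_{-r-1}`
    have h := ih (f := f ∘ₗ psiStar (-((r : ℤ) + 1)))
      (fun n hn v => by
        rw [LinearMap.comp_apply, psiStar_psi, if_neg (by omega), zero_sub, map_neg,
          hψ n (by omega), neg_zero])
      (fun n hn v => by
        rw [LinearMap.comp_apply]
        rcases eq_or_ne n (-((r : ℤ) + 1)) with rfl | h
        · rw [psiStar_psiStar_self, map_zero]
        · rw [psiStar_psiStar, map_neg, hψ' n (by omega), neg_zero])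
    refine LinearMap.ext fun v => ?_
    have hv := LinearMap.congr_fun h (psi (-((r : ℤ) + 1)) v)
    rw [LinearMap.comp_apply, psiStar_psi, if_pos rfl, map_sub, hψ _ (by omega), sub_zero] at hv
    exact hv

lemma opH_shiftedVac (x y : List k) (r : ℕ) : opH x y (shiftedVac r : Fock k) = 0 := by
  induction r with
  | zero => exact opH_vac x y
  | succ r ih =>
    have h := neg_opH_psiStar x y (-((r : ℤ) + 1)) (shiftedVac r)
    rw [pairing_logSeries x y (N := 0) fun j hj => psiStar_shiftedVac (by omega),
      LinearMap.neg_apply, LinearMap.neg_apply, ih] at h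
    rw [shiftedVac]
    simpa [add_comm] using h

lemma expH_shiftedVac (x y : List k) (r : ℕ) :
    expH x y (shiftedVac r : Fock k) = shiftedVac r :=
  expEnd_apply_eq_self _ (opH_shiftedVac x y r)

lemma expNegH_shiftedVac (x y : List k) (r : ℕ) :
    expNegH x y (shiftedVac r : Fock k) = shiftedVac r :=
  expEnd_apply_eq_self _ (by rw [LinearMap.neg_apply, opH_shiftedVac, neg_zero])

/-- `⟨-r-1| e^{-H(t)} ψ*_{-r-1} = ⟨-r|`. Although `⟨-r-1|` is not fixed by `e^{-H(t)}`, the left side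
satisfies the conditions that characterise `⟨-r|`. -/
lemma shiftedBraVac_succ_expNegH_psiStar (t : k) (r : ℕ) (v : Fock k) :
    shiftedBraVac (r + 1) (expNegH [t] [] (psiStar (-((r : ℤ) + 1)) v)) = shiftedBraVac r v := by
  have h := eq_smul_shiftedBraVac (r := r)
    (f := shiftedBraVac (r + 1) ∘ₗ expNegH [t] [] ∘ₗ psiStar (-((r : ℤ) + 1))) ?_ ?_
  · have h1 : (shiftedBraVac (r + 1) ∘ₗ expNegH [t] [] ∘ₗ psiStar (-((r : ℤ) + 1)))
        (shiftedVac r : Fock k) = 1 := by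
      change shiftedBraVac (r + 1) (expNegH [t] [] (shiftedVac (r + 1))) = 1
      rw [expNegH_shiftedVac, shiftedBraVac_shiftedVac]
    rw [h1, one_smul] at h
    exact LinearMap.congr_fun h v
  · intro n hn v
    simp only [LinearMap.comp_apply]
    rw [psiStar_psi, if_neg (by omega), zero_sub, map_neg, map_neg, expNegH_psi, map_sub,
      map_smul, shiftedBraVac_psi (by push_cast; omega), shiftedBraVac_psi (by push_cast; omega),
      smul_zero, sub_zero, neg_zero]
  · suffices h : ∀ (d : ℕ) (v : Fock k), shiftedBraVac (r + 1)
        (expNegH [t] [] (psiStar (-((r : ℤ) + 1) - d) (psiStar (-((r : ℤ) + 1)) v))) = 0 by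
      intro n hn v
      obtain ⟨d, rfl⟩ : ∃ d : ℕ, n = -((r : ℤ) + 1) - d :=
        ⟨(-((r : ℤ) + 1) - n).toNat, by omega⟩
      simp only [LinearMap.comp_apply]
      rw [psiStar_psiStar, map_neg, map_neg, h, neg_zero]
    intro d v
    induction d with
    | zero => simp [psiStar_psiStar_self]
    | succ d ih =>
      -- `⟨-r-1| e^{-H(t)} ψ*_n = t ⟨-r-1| e^{-H(t)} ψ*_{n+1}` for `n < -r-1`
      have hn : -((r : ℤ) + 1) - (d + 1 : ℕ) + 1 = -((r : ℤ) + 1) - d := by push_cast; ring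
      have h := congrArg (shiftedBraVac (r + 1)) (LinearMap.congr_fun
        (expNegH_mul_psiStar t (-((r : ℤ) + 1) - (d + 1 : ℕ))) (psiStar (-((r : ℤ) + 1)) v))
      simp only [Module.End.mul_apply, LinearMap.sub_apply, LinearMap.smul_apply, map_sub,
        map_smul, hn, ih] at h
      rwa [shiftedBraVac_psiStar (by push_cast; omega), smul_zero, sub_zero] at h

end ShiftedVacua

/-! ### Pairing of partial products -/

section Tails

/-- The product `ψ_{a_i} e^{H(t_i)} ⋯ ψ_{a_{i+m-1}} e^{H(t_{i+m-1})} |-r⟩`. -/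
def ketTail (t : ℕ → k) (a : ℕ → ℤ) (r i m : ℕ) : Fock k :=
  (((List.range' i m).map fun j => psi (a j) * expH [t j] []).prod : Module.End k (Fock k))
    (shiftedVac r)

/-- The product `⟨-r| e^{-H(t_{i+m-1})} ψ*_{b_{i+m-1}} ⋯ e^{-H(t_i)} ψ*_{b_i}`. -/
def braTail (t : ℕ → k) (b : ℕ → ℤ) (r i m : ℕ) : Module.Dual k (Fock k) :=
  shiftedBraVac r ∘ₗ
    ((List.range' i m).map fun j => expNegH [t j] [] * psiStar (b j)).reverse.prod

lemma ketTail_succ (t : ℕ → k) (a : ℕ → ℤ) (r i m : ℕ) :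
    ketTail t a r i (m + 1) = psi (a i) (expH [t i] [] (ketTail t a r (i + 1) m)) := by
  simp [ketTail, List.range'_succ]

lemma braTail_succ (t : ℕ → k) (b : ℕ → ℤ) (r i m : ℕ) (v : Fock k) :
    braTail t b r i (m + 1) v =
      braTail t b r (i + 1) m (expNegH [t i] [] (psiStar (b i) v)) := by
  simp [braTail, List.range'_succ]

variable [CharZero k]

/-- The operators `e^{H(t)}` preserve the space killed by all `ψ*_n` with `n > c`. -/
lemma psiStar_expH_eq_zero (t : k) {c : ℤ} {v : Fock k} (hv : ∀ n, c < n → psiStar n v = 0)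
    {n : ℤ} (hn : c < n) : psiStar n (expH [t] [] v) = 0 := by
  obtain ⟨N, hN⟩ := exists_forall_psiStar_eq_zero n (expH [t] [] v)
  suffices h : ∀ d j : ℕ, N ≤ j + d → psiStar (n + j) (expH [t] [] v) = 0 by
    simpa using h N 0 (by omega)
  intro d
  induction d with
  | zero => exact fun j hj => hN j hj
  | succ d ih =>
    intro j hj
    have h := expH_psiStar t (n + j) v
    have h' := ih (j + 1) (by omega)
    push_cast at h'
    rw [hv _ (by omega), map_zero, add_assoc, h', smul_zero, sub_zero] at h
    exact h.symm

lemma psiStar_ketTail (t : ℕ → k) {a : ℕ → ℤ} (ha : StrictAnti a) {r : ℕ}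
    (har : -((r : ℤ) + 1) ≤ a r) {i m : ℕ} (him : i + m = r) {n : ℤ} (hn : a i < n) :
    psiStar n (ketTail t a r i m) = 0 := by
  induction m generalizing i n with
  | zero =>
    obtain rfl : i = r := him
    exact psiStar_shiftedVac (by omega)
  | succ m ih =>
    have hi : a (i + 1) < a i := ha i.lt_succ_self
    rw [ketTail_succ, psiStar_psi, if_neg hn.ne, zero_sub,
      psiStar_expH_eq_zero _ (fun n hn => ih (by omega) hn) (hi.trans hn), map_zero, neg_zero]

lemma braTail_psi (t : ℕ → k) {b : ℕ → ℤ} (hb : StrictAnti b) {r : ℕ}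
    (hbr : -((r : ℤ) + 1) ≤ b r) {i m : ℕ} (him : i + m = r) {n : ℤ} (hn : b i < n)
    (v : Fock k) : braTail t b r i m (psi n v) = 0 := by
  induction m generalizing i n v with
  | zero =>
    obtain rfl : i = r := him
    exact shiftedBraVac_psi (by omega) v
  | succ m ih =>
    have hi : b (i + 1) < b i := hb i.lt_succ_self
    rw [braTail_succ, psiStar_psi, if_neg hn.ne', zero_sub, map_neg, map_neg, expNegH_psi,
      map_sub, map_smul, ih (by omega) (by omega), ih (by omega) (by omega), smul_zero, sub_zero,
      neg_zero]

/-- Only the contraction of adjacent outermost fermions survives, so the pairing factorises. -/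
lemma braTail_ketTail (t : ℕ → k) {a b : ℕ → ℤ} (ha : StrictAnti a) (hb : StrictAnti b) {r : ℕ}
    (har : -((r : ℤ) + 1) ≤ a r) (hbr : -((r : ℤ) + 1) ≤ b r) {i m : ℕ} (him : i + m = r) :
    braTail t b r i m (ketTail t a r i m) = if ∀ j ∈ List.range' i m, a j = b j then 1 else 0 := by
  induction m generalizing i with
  | zero => simpa [braTail, ketTail] using shiftedBraVac_shiftedVac r
  | succ m ih =>
    rcases lt_trichotomy (a i) (b i) with h | h | h
    · rw [braTail_succ, psiStar_ketTail t ha har him h, map_zero, map_zero, if_neg]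
      exact fun hab => h.ne (hab i (by simp [List.mem_range']))
    · have hi : a (i + 1) < a i := ha i.lt_succ_self
      rw [braTail_succ, ketTail_succ, ← h, psiStar_psi, if_pos rfl,
        psiStar_expH_eq_zero _ (fun n hn => psiStar_ketTail t ha har (by omega) hn) hi, map_zero,
        sub_zero, ← Module.End.mul_apply, expNegH_mul_expH, Module.End.one_apply, ih (by omega)]
      refine if_congr ?_ rfl rfl
      rw [List.range'_succ, List.forall_mem_cons]
      exact (and_iff_right h).symm
    · rw [ketTail_succ, braTail_psi t hb hbr him h, if_neg]
      exact fun hab => h.ne' (hab i (by simp [List.mem_range']))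

end Tails

/-! ### Mode indices of a partition -/

section Partitions

lemma rowLen_eq_zero {lam : YoungDiagram} {i : ℕ} (h : len lam ≤ i) : lam.rowLen i = 0 := by
  by_contra h0
  have h1 := YoungDiagram.mem_iff_lt_rowLen.2 (Nat.pos_of_ne_zero h0)
  exact absurd (YoungDiagram.mem_iff_lt_colLen.1 h1) (not_lt.2 h)

lemma modeIdx_of_len_le {lam : YoungDiagram} {i : ℕ} (h : len lam ≤ i) :
    modeIdx lam i = -((i : ℤ) + 1) := by
  simp [modeIdx, rowLen_eq_zero h]

lemma modeIdx_strictAnti (lam : YoungDiagram) : StrictAnti (modeIdx lam) := by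
  refine strictAnti_nat_of_succ_lt fun i => ?_
  have := lam.rowLen_anti i (i + 1) (Nat.le_succ i)
  simp only [modeIdx]
  push_cast
  omega

lemma forall_modeIdx_eq_iff {lam mu : YoungDiagram} {r : ℕ} (hl : len lam ≤ r)
    (hm : len mu ≤ r) : (∀ j ∈ List.range r, modeIdx lam j = modeIdx mu j) ↔ lam = mu := by
  refine ⟨fun h => ?_, by rintro rfl; simp⟩
  have hrow : ∀ i, lam.rowLen i = mu.rowLen i := by
    intro i
    rcases lt_or_ge i r with hi | hi
    · have := h i (List.mem_range.2 hi)
      simp only [modeIdx] at this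
      omega
    · rw [rowLen_eq_zero (hl.trans hi), rowLen_eq_zero (hm.trans hi)]
  refine YoungDiagram.ext (Finset.ext fun ⟨i, j⟩ => ?_)
  rw [YoungDiagram.mem_cells, YoungDiagram.mem_cells, YoungDiagram.mem_iff_lt_rowLen,
    YoungDiagram.mem_iff_lt_rowLen, hrow]

end Partitions

/-! ### The refined vectors -/

section RefinedVectors

variable [CharZero k]

lemma multiKet_refinedTuple (t : ℕ → k) (lam : YoungDiagram) (r : ℕ) :
    multiKet (refinedTuple t) (fun _ => []) lam r = refinedKet t lam r := by
  -- the exponentials telescope, since `H(t[i+1]) = H(t[i]) + H(t_i)`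
  have h : (((List.range r).map fun i => expH (refinedTuple t i) [] * psi (modeIdx lam i) *
      expNegH (refinedTuple t i) []).prod : Module.End k (Fock k)) =
      ((List.range r).map fun i => psi (modeIdx lam i) * expH [t i] []).prod *
        expNegH (refinedTuple t r) [] := by
    induction r with
    | zero =>
      have := expH_mul_expNegH (k := k) [] []
      rw [expH_nil, one_mul] at this
      simp [refinedTuple, this]
    | succ r ih =>
      have hr : refinedTuple t (r + 1) = refinedTuple t r ++ [t r] := by
        simp [refinedTuple, List.range_succ]
      have hexp : expNegH (refinedTuple t r) [] =
          expH [t r] [] * expNegH (refinedTuple t (r + 1)) [] := by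
        have := expH_append (refinedTuple t r) [t r] [] []
        rw [List.append_nil, ← hr] at this
        calc expNegH (refinedTuple t r) []
            = expNegH (refinedTuple t r) [] *
                (expH (refinedTuple t (r + 1)) [] * expNegH (refinedTuple t (r + 1)) []) := by
              rw [expH_mul_expNegH, mul_one]
          _ = _ := by
              rw [this, ← mul_assoc, ← mul_assoc, expNegH_mul_expH, one_mul]
      rw [List.range_succ, List.map_append, List.map_append, List.prod_append, List.prod_append,
        ih]
      simp only [List.map_cons, List.map_nil, List.prod_cons, List.prod_nil, mul_one, mul_assoc]
      rw [← mul_assoc (expNegH _ _) (expH _ _), expNegH_mul_expH, one_mul, hexp]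
  rw [multiKet, refinedKet, h, Module.End.mul_apply, expNegH_shiftedVac]

lemma refinedKet_succ (t : ℕ → k) {lam : YoungDiagram} {r : ℕ} (h : len lam ≤ r) :
    refinedKet t lam (r + 1) = refinedKet t lam r := by
  simp only [refinedKet, List.range_succ, List.map_append, List.prod_append, List.map_cons,
    List.map_nil, List.prod_cons, List.prod_nil, mul_one, Module.End.mul_apply]
  rw [expH_shiftedVac, modeIdx_of_len_le h, psi_shiftedVac_succ]

lemma refinedBra_succ (t : ℕ → k) {mu : YoungDiagram} {r : ℕ} (h : len mu ≤ r) :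
    refinedBra t mu (r + 1) = refinedBra t mu r := by
  refine LinearMap.ext fun v => ?_
  simp only [refinedBra, List.range_succ, List.map_append, List.reverse_append, List.map_cons,
    List.map_nil, List.reverse_singleton, List.singleton_append, List.prod_cons,
    LinearMap.comp_apply, Module.End.mul_apply]
  rw [modeIdx_of_len_le h, shiftedBraVac_succ_expNegH_psiStar]

lemma refinedKet_eq (t : ℕ → k) {lam : YoungDiagram} {r : ℕ} (h : len lam ≤ r) :
    refinedKet t lam r = refinedKet t lam (len lam) := by
  induction r, h using Nat.le_induction with
  | base => rfl
  | succ r h ih => rw [refinedKet_succ t h, ih]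

lemma refinedBra_eq (t : ℕ → k) {mu : YoungDiagram} {r : ℕ} (h : len mu ≤ r) :
    refinedBra t mu r = refinedBra t mu (len mu) := by
  induction r, h using Nat.le_induction with
  | base => rfl
  | succ r h ih => rw [refinedBra_succ t h, ih]

open scoped Classical in
lemma refinedBra_refinedKet (t : ℕ → k) {lam mu : YoungDiagram} {r : ℕ} (hl : len lam ≤ r)
    (hm : len mu ≤ r) : refinedBra t mu r (refinedKet t lam r) = if lam = mu then 1 else 0 := by
  have h := braTail_ketTail t (modeIdx_strictAnti lam) (modeIdx_strictAnti mu)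
    (modeIdx_of_len_le hl).ge (modeIdx_of_len_le hm).ge (zero_add r)
  rw [ketTail, braTail, ← List.range_eq_range'] at h
  rw [refinedBra, refinedKet, h]
  exact if_congr (forall_modeIdx_eq_iff hl hm) rfl rfl

end RefinedVectors

end FreeFermion

end
open scoped Classical in
/-- The vectors `|λ⟩_{[t]}` and `_{[t]}⟨μ|` do not depend on the number of factors used to compute
them, `|λ⟩_{[t]}` is the vector `|λ⟩_{x/y}` for `x = [t]`, `y = ∅`, and
`_{[t]}⟨μ|λ⟩_{[t]} = δ_{λ,μ}`. -/
theorem theorem3p1 {k : Type*} [Field k] [CharZero k] (t : ℕ → k) :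
    (∀ (lam : YoungDiagram) (r : ℕ), FreeFermion.len lam ≤ r →
      FreeFermion.multiKet (FreeFermion.refinedTuple t) (fun _ => []) lam r =
        FreeFermion.refinedKet t lam r) ∧
    (∀ (lam : YoungDiagram) (r : ℕ), FreeFermion.len lam ≤ r →
      FreeFermion.refinedKet t lam r = FreeFermion.refinedKet t lam (FreeFermion.len lam)) ∧
    (∀ (mu : YoungDiagram) (r : ℕ), FreeFermion.len mu ≤ r →
      FreeFermion.refinedBra t mu r = FreeFermion.refinedBra t mu (FreeFermion.len mu)) ∧
    (∀ (lam mu : YoungDiagram) (r s : ℕ), FreeFermion.len lam ≤ r → FreeFermion.len mu ≤ s →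
      FreeFermion.refinedBra t mu s (FreeFermion.refinedKet t lam r) =
        if lam = mu then 1 else 0) := by
  refine ⟨fun lam r _ => FreeFermion.multiKet_refinedTuple t lam r,
    fun lam r h => FreeFermion.refinedKet_eq t h, fun mu r h => FreeFermion.refinedBra_eq t h,
    fun lam mu r s hr hs => ?_⟩
  have hl := hr.trans (le_max_left r s)
  have hm := hs.trans (le_max_right r s)
  rw [FreeFermion.refinedKet_eq t hr, ← FreeFermion.refinedKet_eq t hl,
    FreeFermion.refinedBra_eq t hs, ← FreeFermion.refinedBra_eq t hm]
  exact FreeFermion.refinedBra_refinedKet t hl hm
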